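/- All logarithms are in base $2$. For positive integers $n,\lambda$, a bipartite covering of the complete multigraph $K_n^{\lambda}$ (vertex set $[n]=\{1,\dots,n\}$, every two distinct vertices joined by $\lambda$ parallel edges) is a finite family, repetitions allowed, of bipartite graphs $H_1,\dots,H_m$ with $V(H_i)\subseteq[n]$, such that every pair of distinct vertices of $[n]$ is an edge of at least $\lambda$ of the graphs $H_i$. Its capacity is $\sum_i|V(H_i)|$, and $\mathrm{cap}(n,\lambda)$ is the minimum possible capacity of a bipartite covering of $K_n^{\lambda}$. Let $k(n,\lambda)$ be the minimum length of a binary code with (minimum Hamming) distance at least $\lambda$ which has at least $n$ codewords. **Theorem (Upper bound).** For all positive integers $n,\lambda$, $$\mathrm{cap}(n,\lambda)\le n\cdot k(n,\lambda).$$ Moreover: 1. For every $n\ge 2$, $\ \mathrm{cap}(n,2)\le n(\lceil\log n\rceil+1)<n(\log n+2)$. 2. For all integers $n\ge 1$ and $\lambda\ge 2$ with $\lambda\le 0.5\log n$, $$\mathrm{cap}(n,\lambda)\le n\Big[\log n+(\lambda-1)\Big(\log\Big(\frac{\log n}{\lambda-1}\Big)+4\Big)\Big].$$ 3. For every real $0<c<1/2$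 and all positive integers $n,\lambda$ with $\lambda\ge c\,\frac{\log n}{1-H(c)}$, where $H(x)=-x\log x-(1-x)\log(1-x)$ is the binary entropy function, $$\mathrm{cap}(n,\lambda)\le\frac{\lambda}{c}\,n.$$ 4. For every fixed integer $\lambda\ge 1$ there are infinitely many $n$ such that $$\mathrm{cap}(n,\lambda)\le n\big[\log n+\lfloor(\lambda-1)/2\rfloor\log\log n+2\big].$$ -/

import Mathlib

/-- A bipartite graph on (a subset of) the vertex set `Fin n` is a subgraph `H` of the complete graph
on `Fin n`, with its own vertex set `H.verts`, that is bipartite. An indexed family `H` of bipartite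
graphs (repetitions allowed) is a bipartite covering of the complete multigraph in which any two
distinct vertices of `Fin n` are joined by `lam` parallel edges, if any two distinct vertices are
adjacent in at least `lam` members of the family. -/
def IsBipartiteCovering (n lam : ℕ) {m : ℕ}
    (H : Fin m → (⊤ : SimpleGraph (Fin n)).Subgraph) : Prop :=
  (∀ i, (H i).coe.IsBipartite) ∧
    ∀ u v : Fin n, u ≠ v → lam ≤ {i : Fin m | (H i).Adj u v}.ncard

/-- The capacity of a family of graphs: the sum of the numbers of their vertices. -/
noncomputable def capacity {n m : ℕ} (H : Fin m → (⊤ : SimpleGraph (Fin n)).Subgraph) : ℕ :=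
  ∑ i, (H i).verts.ncard

/-- The capacities of all (finite) bipartite coverings of the complete multigraph. -/
def capacitySet (n lam : ℕ) : Set ℕ :=
  {s | ∃ (m : ℕ) (H : Fin m → (⊤ : SimpleGraph (Fin n)).Subgraph),
    IsBipartiteCovering n lam H ∧ capacity H = s}

/-- The minimum possible capacity of a bipartite covering of the complete multigraph on `n`
vertices with edge multiplicity `lam`; a minimum by `capacitySet_nonempty`. -/
noncomputable def cap (n lam : ℕ) : ℕ := sInf (capacitySet n lam)

/-- The set of words `C` is a binary code with (minimum Hamming) distance at least `lam`. -/
def HasDistanceAtLeast {k : ℕ} (lam : ℕ) (C : Finset (Fin k → Bool)) : Prop :=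
  ∀ x ∈ C, ∀ y ∈ C, x ≠ y → lam ≤ hammingDist x y

/-- The lengths of the binary codes with distance at least `lam` and at least `n` codewords. -/
def codeLengthSet (n lam : ℕ) : Set ℕ :=
  {k | ∃ C : Finset (Fin k → Bool), HasDistanceAtLeast lam C ∧ n ≤ C.card}

/-- The minimum length of a binary code with distance at least `lam` and at least `n` codewords;
a minimum by `codeLengthSet_nonempty`. -/
noncomputable def minCodeLength (n lam : ℕ) : ℕ := sInf (codeLengthSet n lam)

/-- The binary entropy function, with logarithms in base `2`. -/
noncomputable def binaryEntropy (x : ℝ) : ℝ :=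
  -x * Real.logb 2 x - (1 - x) * Real.logb 2 (1 - x)

theorem capacitySet_nonempty (n lam : ℕ) : (capacitySet n lam).Nonempty := by
  let S : Fin n → (⊤ : SimpleGraph (Fin n)).Subgraph := fun a =>
    { verts := Set.univ
      Adj := fun u v => u ≠ v ∧ (u = a ∨ v = a)
      adj_sub := fun h => h.1
      edge_vert := fun _ => Set.mem_univ _
      symm := ⟨fun u v h => ⟨h.1.symm, h.2.symm⟩⟩ }
  refine ⟨_, n * lam, fun i => S (finProdFinEquiv.symm i).1, ⟨fun i => ?_, fun u v huv => ?_⟩, rfl⟩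
  · show (S (finProdFinEquiv.symm i).1).coe.IsBipartite
    generalize (finProdFinEquiv.symm i).1 = a
    refine ⟨SimpleGraph.Coloring.mk (fun u => if u.1 = a then (0 : Fin 2) else 1) ?_⟩
    rintro ⟨u, hu⟩ ⟨v, hv⟩ h
    have h' : u ≠ v ∧ (u = a ∨ v = a) := h
    grind
  · have hinj : Function.Injective (fun t : Fin lam => finProdFinEquiv (u, t)) := by
      intro s t h
      simpa using h
    have := Set.ncard_le_ncard (s := Set.range (fun t : Fin lam => finProdFinEquiv (u, t)))
      (t := {i : Fin (n * lam) | (S (finProdFinEquiv.symm i).1).Adj u v})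
      (by rintro _ ⟨t, rfl⟩
          simp only [Set.mem_ofPred_eq, Equiv.symm_apply_apply]
          exact ⟨huv, Or.inl rfl⟩) (Set.toFinite _)
    rwa [← Set.image_univ, Set.ncard_image_of_injective _ hinj, Set.ncard_univ,
      Nat.card_eq_fintype_card, Fintype.card_fin] at this

theorem codeLengthSet_nonempty (n lam : ℕ) : (codeLengthSet n lam).Nonempty := by
  let w : Fin n → Fin (n * (lam + 1)) → Bool :=
    fun j i => decide ((finProdFinEquiv.symm i).1 = j)
  have key : ∀ a b : Fin n, a ≠ b → lam + 1 ≤ hammingDist (w a) (w b) := by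
    intro a b hab
    have hinj : Function.Injective (fun t : Fin (lam + 1) => finProdFinEquiv (a, t)) := by
      intro s t h
      simpa using h
    calc lam + 1 = (Finset.univ.image (fun t : Fin (lam + 1) => finProdFinEquiv (a, t))).card := by
          rw [Finset.card_image_of_injective _ hinj]; simp
      _ ≤ hammingDist (w a) (w b) := by
          refine Finset.card_le_card ?_
          intro i hi
          obtain ⟨t, -, rfl⟩ := Finset.mem_image.1 hi
          have hne : w a (finProdFinEquiv (a, t)) ≠ w b (finProdFinEquiv (a, t)) := by
            simp only [w, Equiv.symm_apply_apply]
            simp [hab]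
          simpa using hne
  have hw : Function.Injective w := by
    intro a b h
    by_contra hab
    have := key a b hab
    rw [h, hammingDist_self] at this
    omega
  refine ⟨n * (lam + 1), Finset.univ.image w, ?_, ?_⟩
  · intro x hx y hy hxy
    obtain ⟨a, -, rfl⟩ := Finset.mem_image.1 hx
    obtain ⟨b, -, rfl⟩ := Finset.mem_image.1 hy
    have := key a b (fun h => hxy (by rw [h]))
    omega
  · rw [Finset.card_image_of_injective _ hw]; simp

/-!
A binary code of length `k` with `n` words and distance `lam` gives a bipartite covering of capacity
`n * k`: label the vertices by codewords and take, for each coordinate, the complete bipartite graph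
between the words with bit `0` and those with bit `1` (`cap_le_of_mem_codeLengthSet`). All bounds on
the capacity therefore follow from the existence of short codes.

* Multiplicity `2` uses the parity-check code (`mem_codeLengthSet_two`).
* The bound for `lam ≤ logb 2 n / 2` and the entropy bound use the Gilbert bound
  (`mem_codeLengthSet_of_mul_pow_le`): a maximal code of distance `d + 1` has at least
  `2 ^ k / V` words, where `V` is the size of a Hamming ball of radius `d`. The estimate
  `V * x ^ d ≤ (1 + x) ^ k`, valid for `0 < x ≤ 1`, is used with `x` chosen in each case so that the
  rounding of `k` to an integer does not cost more than the bounds allow.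
* The bound for infinitely many `n` uses extended BCH codes (`mem_codeLengthSet_two_pow`). No linear
  algebra is needed: a large class of words with equal syndromes is taken as the code, by the
  pigeonhole principle, and its distance is bounded by a Vandermonde-type argument on power sums
  (`Finset.exists_sum_pow_ne_zero`).
-/

/-! ### Bipartite coverings from codes -/

/-- Label the vertices by distinct codewords of a code of length `k`. The `i`-th graph is the complete
bipartite graph between the words whose `i`-th bit is `1` and those whose `i`-th bit is `0`, so two
vertices are adjacent in as many graphs as the Hamming distance of their labels. -/
theorem cap_le_of_mem_codeLengthSet {n lam k : ℕ} (hk : k ∈ codeLengthSet n lam) :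
    cap n lam ≤ n * k := by
  obtain ⟨C, hC, hn⟩ := hk
  obtain ⟨w⟩ : Nonempty (Fin n ↪ C) := by
    apply Function.Embedding.nonempty_of_card_le
    simpa using hn
  let H : Fin k → (⊤ : SimpleGraph (Fin n)).Subgraph := fun i =>
    { verts := Set.univ
      Adj := fun u v => (w u).1 i ≠ (w v).1 i
      adj_sub := fun {u v} h => by
        rintro rfl
        exact h rfl
      edge_vert := fun _ => Set.mem_univ _
      symm := ⟨fun u v h => Ne.symm h⟩ }
  refine Nat.sInf_le ⟨k, H, ⟨fun i => ?_, fun u v huv => ?_⟩, ?_⟩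
  · refine ⟨SimpleGraph.Coloring.mk (fun u => if (w u.1).1 i then (0 : Fin 2) else 1) ?_⟩
    rintro ⟨u, hu⟩ ⟨v, hv⟩ h
    have h' : (w u).1 i ≠ (w v).1 i := h
    grind
  · have hne : (w u).1 ≠ (w v).1 := fun h => huv (w.injective (Subtype.ext h))
    refine (hC _ (w u).2 _ (w v).2 hne).trans (le_of_eq ?_)
    change _ = {i : Fin k | (w u).1 i ≠ (w v).1 i}.ncard
    rw [hammingDist, ← Set.ncard_coe_finset]
    simp
  · simp [capacity, H, mul_comm]

/-! ### The Gilbert bound -/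

/-- Chernoff-type bound for the size of a Hamming ball of radius `d`: weight each word `v` by
`x ^ hammingDist w v`, which is at least `x ^ d` on the ball, and use that the weights of all words
sum to `(1 + x) ^ k`. -/
theorem card_filter_hammingDist_lt_mul_pow_le {k d : ℕ} (w : Fin k → Bool) {x : ℝ} (hx0 : 0 < x)
    (hx1 : x ≤ 1) :
    ((Finset.univ.filter fun v => hammingDist w v < d + 1).card : ℝ) * x ^ d ≤ (1 + x) ^ k := by
  classical
  have hsum := Fintype.sum_pow_mul_eq_add_pow (Fin k) x 1
  rw [Fintype.card_fin, add_comm] at hsum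
  rw [← hsum, ← nsmul_eq_mul, ← Finset.sum_const]
  let D : (Fin k → Bool) → Finset (Fin k) := fun v => Finset.univ.filter fun i => w i ≠ v i
  have hD : Function.Injective D := by
    intro u v huv
    funext i
    have := congrArg (fun s => i ∈ s) huv
    simp only [D, Finset.mem_filter_univ, eq_iff_iff] at this
    revert this
    cases w i <;> cases u i <;> cases v i <;> simp
  calc ∑ v ∈ Finset.univ.filter (fun v => hammingDist w v < d + 1), x ^ d
      ≤ ∑ v ∈ Finset.univ.filter (fun v => hammingDist w v < d + 1), x ^ (D v).card := by
        refine Finset.sum_le_sum fun v hv => pow_le_pow_of_le_one hx0.le hx1 ?_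
        have := (Finset.mem_filter.1 hv).2
        exact Nat.lt_succ_iff.1 this
    _ ≤ ∑ v, x ^ (D v).card :=
        Finset.sum_le_sum_of_subset_of_nonneg (Finset.subset_univ _) fun _ _ _ => by positivity
    _ = ∑ s ∈ Finset.univ.image D, x ^ s.card :=
        (Finset.sum_image (f := fun s => x ^ s.card) fun _ _ _ _ h => hD h).symm
    _ ≤ ∑ s : Finset (Fin k), x ^ s.card * 1 ^ (k - s.card) := by
        simp only [one_pow, mul_one]
        exact Finset.sum_le_sum_of_subset_of_nonneg (Finset.subset_univ _)
          fun _ _ _ => by positivity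

/-- The Gilbert bound: the balls of radius `d` around the words of a maximal code of distance
`d + 1` cover all words. The size of a ball enters through its Chernoff-type bound with parameter `x`. -/
theorem mem_codeLengthSet_of_mul_pow_le {n k d : ℕ} {x : ℝ} (hx0 : 0 < x) (hx1 : x ≤ 1)
    (h : (n : ℝ) * (1 + x) ^ k ≤ 2 ^ k * x ^ d) : k ∈ codeLengthSet n (d + 1) := by
  classical
  obtain ⟨C, hC⟩ := Set.Finite.exists_maximal
    (Set.toFinite {C : Finset (Fin k → Bool) | HasDistanceAtLeast (d + 1) C})
    ⟨∅, by simp [HasDistanceAtLeast]⟩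
  have hcode : HasDistanceAtLeast (d + 1) C := hC.prop
  refine ⟨C, hcode, ?_⟩
  -- A word outside every ball could be added to the maximal code.
  have hcover : (Finset.univ : Finset (Fin k → Bool)) ⊆
      C.biUnion fun w => Finset.univ.filter fun v => hammingDist w v < d + 1 := by
    intro v _
    by_contra hv
    simp only [Finset.mem_biUnion, Finset.mem_filter_univ, not_exists, not_and, not_lt] at hv
    have hins : HasDistanceAtLeast (d + 1) (insert v C) := by
      intro a ha b hb hab
      rcases Finset.mem_insert.1 ha with rfl | haC
      · rcases Finset.mem_insert.1 hb with rfl | hbC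
        · exact absurd rfl hab
        · rw [hammingDist_comm]
          exact hv b hbC
      · rcases Finset.mem_insert.1 hb with rfl | hbC
        · exact hv a haC
        · exact hcode a haC b hbC hab
    have hvC : v ∈ C := hC.le_of_ge hins (Finset.subset_insert v C) (Finset.mem_insert_self v C)
    simpa using hv v hvC
  have hcard : (2 : ℝ) ^ k * x ^ d ≤ C.card * (1 + x) ^ k := by
    have h1 := (Finset.card_le_card hcover).trans Finset.card_biUnion_le
    have h2 : (2 : ℝ) ^ k ≤
        ∑ w ∈ C, ((Finset.univ.filter fun v => hammingDist w v < d + 1).card : ℝ) := by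
      simp only [Finset.card_univ, Fintype.card_fun, Fintype.card_bool, Fintype.card_fin] at h1
      exact_mod_cast h1
    calc (2 : ℝ) ^ k * x ^ d ≤ _ := mul_le_mul_of_nonneg_right h2 (by positivity)
      _ = ∑ w ∈ C,
          ((Finset.univ.filter fun v => hammingDist w v < d + 1).card : ℝ) * x ^ d :=
        Finset.sum_mul _ _ _
      _ ≤ ∑ w ∈ C, (1 + x) ^ k :=
        Finset.sum_le_sum fun w _ => card_filter_hammingDist_lt_mul_pow_le w hx0 hx1
      _ = C.card * (1 + x) ^ k := by simp
  have := le_of_mul_le_mul_right (h.trans hcard) (by positivity)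
  exact_mod_cast this

/-! ### Parity-check and BCH codes -/

/-- The first `#S` power sums of a nonempty set `S` in a field do not all vanish. Otherwise
`∑ a ∈ S, p(a) = 0` for every polynomial `p` of degree less than `#S`, but for the polynomial `p`
with root set `S \ {b}` this sum is `p(b) ≠ 0`. -/
theorem Finset.exists_sum_pow_ne_zero {F : Type*} [Field F] {S : Finset F} (hS : S.Nonempty) :
    ∃ j < S.card, ∑ a ∈ S, a ^ j ≠ 0 := by
  classical
  by_contra! h
  obtain ⟨b, hb⟩ := hS
  let p : Polynomial F := ∏ a ∈ S.erase b, (Polynomial.X - Polynomial.C a)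
  have hdeg : p.natDegree + 1 = S.card := by
    rw [Polynomial.natDegree_finsetProd_X_sub_C_eq_card, Finset.card_erase_add_one hb]
  have h0 : ∑ a ∈ S, p.eval a = 0 := by
    simp only [Polynomial.eval_eq_sum_range]
    rw [Finset.sum_comm]
    refine Finset.sum_eq_zero fun j hj => ?_
    rw [← Finset.mul_sum, h j (by have := Finset.mem_range.1 hj; omega), mul_zero]
  have h1 : ∑ a ∈ S, p.eval a = p.eval b := by
    refine Finset.sum_eq_single_of_mem b hb fun a ha hab => ?_
    rw [Polynomial.eval_prod]
    exact Finset.prod_eq_zero (Finset.mem_erase.2 ⟨hab, ha⟩) (by simp)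
  rw [h1, Polynomial.eval_prod, Finset.prod_eq_zero_iff] at h0
  obtain ⟨a, ha, hab⟩ := h0
  rw [Polynomial.eval_sub, Polynomial.eval_X, Polynomial.eval_C, sub_eq_zero] at hab
  exact (Finset.mem_erase.1 ha).1 hab.symm

/-- In characteristic `2`, if two words have the same syndrome with respect to `f`, then `f` sums to
`0` over the positions where they differ. -/
theorem sum_filter_ne_eq_zero {R : Type*} [CommRing R] [CharP R 2] {k : ℕ} {u v : Fin k → Bool}
    (f : Fin k → R)
    (h : ∑ i, (if u i then f i else 0) = ∑ i, (if v i then f i else 0)) :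
    ∑ i with u i ≠ v i, f i = 0 := by
  rw [← CharTwo.add_eq_zero, ← Finset.sum_add_distrib] at h
  rw [← h, Finset.sum_filter]
  refine Finset.sum_congr rfl fun i _ => ?_
  cases u i <;> cases v i <;> simp [CharTwo.add_self_eq_zero]

/-- The extended BCH code, with evaluation points `e i` in a field `F` of characteristic `2`: the
words are sorted by their syndromes, which consist of the parity of the weight and the power sums
`∑ e i ^ (2 * j + 1)`, `j < t`, over the positions of the ones. Some class has at least `n` words,
and on the set of positions where two of its words differ the power sums of all exponents up to `2 * t`
vanish, so this set has more than `2 * t + 1` elements. -/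
theorem mem_codeLengthSet_of_injective {F : Type*} [Field F] [Fintype F] [CharP F 2] {n k t : ℕ}
    {e : Fin k → F} (he : Function.Injective e) (h : n * (2 * Fintype.card F ^ t) ≤ 2 ^ k) :
    k ∈ codeLengthSet n (2 * t + 2) := by
  classical
  let syn : (Fin k → Bool) → ZMod 2 × (Fin t → F) := fun w =>
    (∑ i, (if w i then 1 else 0), fun j => ∑ i, (if w i then e i ^ (2 * j.1 + 1) else 0))
  obtain ⟨s, -, hs⟩ := Finset.exists_le_card_fiber_of_mul_le_card_of_maps_to
    (s := Finset.univ) (t := Finset.univ) (f := syn) (n := n) (fun _ _ => Finset.mem_univ _)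
    Finset.univ_nonempty (by
      simp only [Finset.card_univ, Fintype.card_prod, ZMod.card, Fintype.card_fun,
        Fintype.card_fin, Fintype.card_bool]
      rw [mul_comm]
      exact h)
  refine ⟨_, fun u hu v hv huv => ?_, hs⟩
  have hsyn : syn u = syn v := by
    rw [(Finset.mem_filter.1 hu).2, (Finset.mem_filter.1 hv).2]
  let D : Finset (Fin k) := Finset.univ.filter fun i => u i ≠ v i
  have hpow : ∀ j ≤ 2 * t, ∑ i ∈ D, e i ^ j = 0 := by
    intro j
    induction j using Nat.strong_induction_on with
    | _ j ih =>
      intro hj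
      rcases Nat.even_or_odd' j with ⟨i, rfl | rfl⟩
      · rcases Nat.eq_zero_or_pos i with rfl | hi
        · have h2 := sum_filter_ne_eq_zero (fun _ => (1 : ZMod 2)) (congrArg Prod.fst hsyn)
          have h3 : (2 : ℕ) ∣ D.card := by
            rw [← ZMod.natCast_eq_zero_iff]
            simpa using h2
          simpa using (CharP.cast_eq_zero_iff F 2 _).2 h3
        -- By the Frobenius map the power sum with exponent `2 * i` is the square of the `i`-th one.
        · have := ih i (by omega) (by omega)
          simp only [mul_comm 2 i, pow_mul]
          rw [← sum_pow_char 2, this, zero_pow two_ne_zero]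
      · exact sum_filter_ne_eq_zero (fun l => e l ^ (2 * i + 1))
          (congrFun (congrArg Prod.snd hsyn) ⟨i, by omega⟩)
  have hD : D.Nonempty := by
    obtain ⟨i, hi⟩ := Function.ne_iff.1 huv
    exact ⟨i, by simpa [D] using hi⟩
  obtain ⟨j, hj, hne⟩ := Finset.exists_sum_pow_ne_zero (hD.image e)
  rw [Finset.card_image_of_injective _ he] at hj
  rw [Finset.sum_image fun _ _ _ _ h => he h] at hne
  by_contra! hlt
  change D.card < 2 * t + 2 at hlt
  exact hne (hpow j (by omega))

/-- The parity-check code, as the extended BCH code without power sums (`t = 0`). -/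
theorem mem_codeLengthSet_two {n k : ℕ} (hk : k ≠ 0) (h : n * 2 ≤ 2 ^ k) :
    k ∈ codeLengthSet n 2 := by
  -- The field only has to contain `k` distinct elements, so `2 ^ k` of them are enough.
  have : Fintype (GaloisField 2 k) := Fintype.ofFinite _
  have hcard : Fintype.card (GaloisField 2 k) = 2 ^ k := by
    rw [← Nat.card_eq_fintype_card, GaloisField.card 2 k hk]
  obtain ⟨e⟩ : Nonempty (Fin k ↪ GaloisField 2 k) := by
    apply Function.Embedding.nonempty_of_card_le
    rw [hcard, Fintype.card_fin]
    exact Nat.lt_two_pow_self.le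
  exact mem_codeLengthSet_of_injective (t := 0) e.injective (by simpa using h)

/-- The extended BCH code whose evaluation points are all elements of the field with `2 ^ m`
elements. -/
theorem mem_codeLengthSet_two_pow {n m t : ℕ} (hm : m ≠ 0)
    (h : n * (2 * (2 ^ m) ^ t) ≤ 2 ^ 2 ^ m) : 2 ^ m ∈ codeLengthSet n (2 * t + 2) := by
  have : Fintype (GaloisField 2 m) := Fintype.ofFinite _
  have hcard : Fintype.card (GaloisField 2 m) = 2 ^ m := by
    rw [← Nat.card_eq_fintype_card, GaloisField.card 2 m hm]
  have e : Fin (2 ^ m) ≃ GaloisField 2 m := (finCongr hcard.symm).trans (Fintype.equivFin _).symm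
  exact mem_codeLengthSet_of_injective e.injective (by rwa [hcard])

theorem codeLengthSet_anti {n lam lam' : ℕ} (h : lam ≤ lam') :
    codeLengthSet n lam' ⊆ codeLengthSet n lam :=
  fun _ ⟨C, hC, hn⟩ => ⟨C, fun x hx y hy hxy => h.trans (hC x hx y hy hxy), hn⟩

/-! ### Multiplicity two -/

theorem cap_two_le {n : ℕ} (hn : 2 ≤ n) :
    (cap n 2 : ℝ) ≤ (n : ℝ) * ((⌈Real.logb 2 (n : ℝ)⌉ : ℝ) + 1) := by
  have hn0 : (0 : ℝ) < n := by positivity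
  have hL : 0 ≤ Real.logb 2 (n : ℝ) :=
    Real.logb_nonneg one_lt_two (by exact_mod_cast (by omega : 1 ≤ n))
  have hk : ⌈Real.logb 2 (n : ℝ)⌉₊ + 1 ∈ codeLengthSet n 2 := by
    refine mem_codeLengthSet_two (Nat.succ_ne_zero _) ?_
    rw [pow_succ]
    refine Nat.mul_le_mul_right 2 ?_
    have h := Nat.le_ceil (Real.logb 2 (n : ℝ))
    rw [Real.logb_le_iff_le_rpow one_lt_two hn0, Real.rpow_natCast] at h
    exact_mod_cast h
  have h := cap_le_of_mem_codeLengthSet hk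
  have hceil : ((⌈Real.logb 2 (n : ℝ)⌉₊ : ℕ) : ℝ) = (⌈Real.logb 2 (n : ℝ)⌉ : ℝ) :=
    natCast_ceil_eq_intCast_ceil hL
  rw [← hceil]
  exact_mod_cast h

/-! ### Capacity bounds from the Gilbert bound -/

/-- The Gilbert bound `mem_codeLengthSet_of_mul_pow_le` in logarithmic form. -/
theorem mem_codeLengthSet_of_logb_le {n k d : ℕ} {x : ℝ} (hn : 1 ≤ n) (hx0 : 0 < x) (hx1 : x ≤ 1)
    (h : Real.logb 2 n + k * Real.logb 2 (1 + x) ≤ k + d * Real.logb 2 x) :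
    k ∈ codeLengthSet n (d + 1) := by
  have hn0 : (0 : ℝ) < n := by exact_mod_cast hn
  refine mem_codeLengthSet_of_mul_pow_le hx0 hx1 ?_
  rw [← Real.logb_le_logb one_lt_two (by positivity) (by positivity),
    Real.logb_mul (by positivity) (by positivity), Real.logb_mul (by positivity) (by positivity),
    Real.logb_pow, Real.logb_pow, Real.logb_pow, Real.logb_self_eq_one one_lt_two, mul_one]
  exact h

theorem logb_two_le_sub_one {y : ℝ} (hy : 2 ≤ y) : Real.logb 2 y ≤ y - 1 := by
  have h := Real.log_le_sub_one_of_pos (show 0 < y / 2 by linarith)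
  rw [Real.log_div (by linarith) two_ne_zero] at h
  have h2 := Real.log_two_gt_d9
  rw [Real.logb, div_le_iff₀ (Real.log_pos one_lt_two)]
  nlinarith

/-- With `y = L / d`, this controls the volume of the ball of radius `d` in `cap_le_of_le_half_logb`.
The constant `7 / 2` leaves room for rounding the length down: `d * (7 / 2) ≤ d * 4 - 1` for
`d ≥ 2`. -/
theorem logb_exp_one_mul_le {y : ℝ} (hy : 2 ≤ y) :
    Real.logb 2 (Real.exp 1 * (y + Real.logb 2 y + 4)) ≤ Real.logb 2 y + 7 / 2 := by
  have hlog := logb_two_le_sub_one hy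
  have hpos : 0 ≤ Real.logb 2 y := Real.logb_nonneg one_lt_two (by linarith)
  have he := Real.exp_one_lt_d9
  have hy0 : 0 < y := by linarith
  -- It suffices that `4 * exp 1 ≤ 10.9 ≤ 2 ^ (7 / 2)`, because `logb 2 y + 4 ≤ 3 * y`.
  have h7 : (10.9 : ℝ) ≤ 2 ^ (7 / 2 : ℝ) := by
    rw [show (7 / 2 : ℝ) = (7 : ℕ) * (1 / 2 : ℝ) by norm_num, Real.rpow_mul two_pos.le,
      ← Real.sqrt_eq_rpow, Real.rpow_natCast]
    exact Real.le_sqrt_of_sq_le (by norm_num)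
  rw [Real.logb_le_iff_le_rpow one_lt_two (by positivity), Real.rpow_add two_pos,
    Real.rpow_logb two_pos (by norm_num) hy0]
  calc Real.exp 1 * (y + Real.logb 2 y + 4) ≤ 2.7182818286 * (4 * y) := by
        gcongr
        linarith
      _ ≤ y * 10.9 := by linarith
      _ ≤ _ := by gcongr

/-- For `lam = d + 1` with `d ≥ 2`, the Gilbert bound is applied with length `⌊R⌋`, where `n * R` is
the claimed bound, and with weight `x = d / R`, for which `(1 + x) ^ ⌊R⌋ ≤ exp d`. The loss from rounding
`R` down is too large for this argument when `d = 1`; there the parity-check code does better. -/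
theorem cap_le_of_le_half_logb {n lam : ℕ} (hn : 1 ≤ n) (hlam : 2 ≤ lam)
    (h : (lam : ℝ) ≤ (1 / 2 : ℝ) * Real.logb 2 (n : ℝ)) :
    (cap n lam : ℝ) ≤ (n : ℝ) * (Real.logb 2 (n : ℝ) +
      ((lam : ℝ) - 1) * (Real.logb 2 (Real.logb 2 (n : ℝ) / ((lam : ℝ) - 1)) + 4)) := by
  obtain ⟨d, rfl⟩ : ∃ d, lam = d + 1 := ⟨lam - 1, by omega⟩
  push_cast at h ⊢
  rw [add_sub_cancel_right]
  set L := Real.logb 2 (n : ℝ) with hL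
  have hd1 : (1 : ℝ) ≤ d := by exact_mod_cast (by omega : 1 ≤ d)
  have hd0 : (0 : ℝ) < d := by linarith
  have hy : 2 ≤ L / d := by
    rw [le_div_iff₀ hd0]
    linarith
  have hlog : 0 ≤ Real.logb 2 (L / d) := Real.logb_nonneg one_lt_two (by linarith)
  rcases Nat.lt_or_ge d 2 with hd | hd
  · obtain rfl : d = 1 := by omega
    have hn2 : 2 ≤ n := by
      by_contra hn2
      obtain rfl : n = 1 := by omega
      norm_num [L] at h
    have hc := Int.ceil_lt_add_one L
    refine (cap_two_le hn2).trans (mul_le_mul_of_nonneg_left ?_ (by positivity))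
    push_cast at hlog ⊢
    linarith
  · have hd2 : (2 : ℝ) ≤ d := by exact_mod_cast hd
    set R := L + d * (Real.logb 2 (L / d) + 4) with hR
    have hRd : R / d = L / d + Real.logb 2 (L / d) + 4 := by
      rw [hR]
      field_simp
      ring
    have hR0 : 0 < R := by
      have : 0 < R / d := by rw [hRd]; linarith
      exact (div_pos_iff_of_pos_right hd0).1 this
    have hkey := logb_exp_one_mul_le hy
    rw [← hRd, Real.logb_mul (by positivity) (by positivity)] at hkey
    have hfl := Nat.floor_le hR0.le
    have hfl' := Nat.lt_floor_add_one R
    have hmem : ⌊R⌋₊ ∈ codeLengthSet n (d + 1) := by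
      refine mem_codeLengthSet_of_logb_le (x := d / R) hn (by positivity) ?_ ?_
      · rw [← one_div_div]
        exact (div_le_one (by positivity)).2 (by rw [hRd]; linarith)
      · have h1 : (⌊R⌋₊ : ℝ) * Real.logb 2 (1 + d / R) ≤ d * Real.logb 2 (Real.exp 1) := by
          have hl : Real.logb 2 (1 + d / R) ≤ d / R * Real.logb 2 (Real.exp 1) := by
            rw [← Real.logb_rpow_eq_mul_logb_of_pos (Real.exp_pos 1), Real.exp_one_rpow]
            refine Real.logb_le_logb_of_le one_lt_two (by positivity) ?_
            linarith [Real.add_one_le_exp (d / R)]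
          have he : 0 ≤ Real.logb 2 (Real.exp 1) :=
            Real.logb_nonneg one_lt_two (Real.one_le_exp zero_le_one)
          calc (⌊R⌋₊ : ℝ) * Real.logb 2 (1 + d / R)
              ≤ R * (d / R * Real.logb 2 (Real.exp 1)) :=
                mul_le_mul hfl hl (Real.logb_nonneg one_lt_two (by
                  linarith [show 0 < d / R by positivity])) hR0.le
            _ = d * Real.logb 2 (Real.exp 1) := by field_simp
        have hinv : Real.logb 2 (d / R) = -Real.logb 2 (R / d) := by
          rw [← inv_div, Real.logb_inv]
        rw [hinv]
        have h2 := mul_le_mul_of_nonneg_left hkey hd0.le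
        rw [← hL]
        linarith
    have hcap : (cap n (d + 1) : ℝ) ≤ n * ⌊R⌋₊ := by
      exact_mod_cast cap_le_of_mem_codeLengthSet hmem
    exact hcap.trans (mul_le_mul_of_nonneg_left hfl (by positivity))

theorem binaryEntropy_eq_binEntropy_div (c : ℝ) :
    binaryEntropy c = Real.binEntropy c / Real.log 2 := by
  simp only [binaryEntropy, Real.binEntropy, Real.logb, Real.log_inv]
  ring

/-- The Gilbert bound with length `⌊K⌋`, `K = lam / c`, and weight `x = c / (1 - c)`. At the real
length `K` and radius `lam` it would read `logb 2 n ≤ K * (1 - binaryEntropy c)`. Rounding `K` down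
costs at most `1 + logb 2 (1 - c)`, and the radius `lam - 1` in place of `lam` gains `logb 2 ((1 - c) / c)`,
which is more. -/
theorem cap_le_of_binaryEntropy {c : ℝ} (hc0 : 0 < c) (hc : c < 1 / 2) {n lam : ℕ} (hn : 1 ≤ n)
    (hlam : 1 ≤ lam) (h : c * (Real.logb 2 (n : ℝ) / (1 - binaryEntropy c)) ≤ (lam : ℝ)) :
    (cap n lam : ℝ) ≤ (lam : ℝ) / c * (n : ℝ) := by
  obtain ⟨d, rfl⟩ : ∃ d, lam = d + 1 := ⟨lam - 1, by omega⟩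
  have hH : binaryEntropy c < 1 := by
    rw [binaryEntropy_eq_binEntropy_div, div_lt_one (Real.log_pos one_lt_two)]
    exact Real.binEntropy_lt_log_two.2 (by norm_num; linarith)
  set K : ℝ := ((d + 1 : ℕ) : ℝ) / c with hK
  have hK0 : 0 < K := by positivity
  have hcK : c * K = d + 1 := by
    rw [hK]
    push_cast
    field_simp
  have hn' : Real.logb 2 n ≤ K * (1 - binaryEntropy c) := by
    rw [← div_le_iff₀ (by linarith), hK, le_div_iff₀ hc0, mul_comm]
    exact h
  have hfl := Nat.floor_le hK0.le
  have hfl' := Nat.lt_floor_add_one K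
  have hc1 : 0 < 1 - c := by linarith
  have hmem : ⌊K⌋₊ ∈ codeLengthSet n (d + 1) := by
    refine mem_codeLengthSet_of_logb_le (x := c / (1 - c)) hn (by positivity)
      ((div_le_one hc1).2 (by linarith)) ?_
    rw [show 1 + c / (1 - c) = (1 - c)⁻¹ by field_simp; ring, Real.logb_inv,
      Real.logb_div hc0.ne' hc1.ne']
    have hup : 1 + Real.logb 2 c ≤ 0 := by
      have : Real.logb 2 c ≤ Real.logb 2 (1 / 2) :=
        Real.logb_le_logb_of_le one_lt_two hc0 hc.le
      rw [one_div, Real.logb_inv, Real.logb_self_eq_one one_lt_two] at this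
      linarith
    have hlow : -1 ≤ Real.logb 2 (1 - c) := by
      have : Real.logb 2 (1 / 2) ≤ Real.logb 2 (1 - c) :=
        Real.logb_le_logb_of_le one_lt_two (by norm_num) (by linarith)
      rwa [one_div, Real.logb_inv, Real.logb_self_eq_one one_lt_two] at this
    have hEq : K * (1 - binaryEntropy c) = K + (d + 1) * Real.logb 2 c + K * Real.logb 2 (1 - c)
        - (d + 1) * Real.logb 2 (1 - c) := by
      rw [← hcK, binaryEntropy]
      ring
    nlinarith [mul_nonneg (show 0 ≤ ⌊K⌋₊ + 1 - K by linarith)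
      (show 0 ≤ 1 + Real.logb 2 (1 - c) by linarith)]
  have hcap : (cap n (d + 1) : ℝ) ≤ n * ⌊K⌋₊ := by
    exact_mod_cast cap_le_of_mem_codeLengthSet hmem
  rw [mul_comm]
  exact hcap.trans (mul_le_mul_of_nonneg_left hfl (by positivity))

/-! ### Capacity bounds from BCH codes -/

/-- With `s = 2 ^ m - 1 - m * t`, the ratio `s / 2 ^ m` tends to `1`, so eventually
`logb 2 s ≥ m - 1 / (t + 1)`. -/
theorem eventually_mul_sub_logb_le (t : ℕ) :
    ∀ᶠ m : ℕ in Filter.atTop, m ≤ 2 ^ m - 1 - m * t ∧ 1 + m * t ≤ 2 ^ m ∧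
      (t : ℝ) * (m - Real.logb 2 ((2 ^ m - 1 - m * t : ℕ) : ℝ)) ≤ 1 := by
  have hlim : Filter.Tendsto (fun m : ℕ => (1 + (m : ℝ) * (t + 1)) / 2 ^ m) Filter.atTop
      (nhds 0) := by
    have h1 := tendsto_pow_const_div_const_pow_of_one_lt 0 (one_lt_two (α := ℝ))
    have h2 := (tendsto_pow_const_div_const_pow_of_one_lt 1 (one_lt_two (α := ℝ))).mul_const
      ((t : ℝ) + 1)
    refine ((h1.add h2).congr fun m => ?_).trans (by simp)
    simp only [pow_zero, pow_one]
    ring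
  have hr : (2 : ℝ) ^ (-(1 / ((t : ℝ) + 1))) < 1 :=
    Real.rpow_lt_one_of_one_lt_of_neg one_lt_two (by
      rw [neg_lt_zero]
      positivity)
  filter_upwards [hlim.eventually_le_const (sub_pos.2 hr)] with m hm
  have hp : (0 : ℝ) < 2 ^ m := by positivity
  have hr0 : (0 : ℝ) < (2 : ℝ) ^ (-(1 / ((t : ℝ) + 1))) := by positivity
  rw [div_le_iff₀ hp] at hm
  have hle : 1 + m * (t + 1) ≤ 2 ^ m := by
    have : 1 + (m : ℝ) * (t + 1) ≤ 2 ^ m := by nlinarith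
    exact_mod_cast this
  rw [mul_add, mul_one] at hle
  refine ⟨by omega, by omega, ?_⟩
  have hcast : ((2 ^ m - 1 - m * t : ℕ) : ℝ) = 2 ^ m - 1 - m * t := by
    rw [Nat.cast_sub (by omega), Nat.cast_sub (by omega)]
    push_cast
    ring
  rw [hcast]
  have hlow : (2 : ℝ) ^ (-(1 / ((t : ℝ) + 1))) * 2 ^ m ≤ 2 ^ m - 1 - m * t := by
    nlinarith [(Nat.cast_nonneg m : (0 : ℝ) ≤ m)]
  have hlog := Real.logb_le_logb_of_le one_lt_two (mul_pos hr0 hp) hlow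
  rw [Real.logb_mul hr0.ne' hp.ne', Real.logb_rpow two_pos (by norm_num), Real.logb_pow,
    Real.logb_self_eq_one one_lt_two, mul_one] at hlog
  calc (t : ℝ) * (m - Real.logb 2 (2 ^ m - 1 - m * t)) ≤ t * (1 / ((t : ℝ) + 1)) := by
        gcongr
        linarith
    _ ≤ 1 := by
        rw [mul_one_div, div_le_one (by positivity)]
        linarith

/-- With `t = ⌊(lam - 1) / 2⌋` and `m` large, `n = 2 ^ s` for `s = 2 ^ m - 1 - m * t` words of length
`2 ^ m = logb 2 n + 1 + m * t` come from the extended BCH code of distance `2 * t + 2 ≥ lam`, and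
`m * t` exceeds `t * logb 2 (logb 2 n)` by at most `1`. -/
theorem infinite_setOf_cap_le {lam : ℕ} (hlam : 1 ≤ lam) :
    {n : ℕ | (cap n lam : ℝ) ≤ (n : ℝ) * (Real.logb 2 (n : ℝ) +
      (⌊((lam : ℝ) - 1) / 2⌋ : ℝ) * Real.logb 2 (Real.logb 2 (n : ℝ)) + 2)}.Infinite := by
  set t := (lam - 1) / 2 with ht
  have hfloor : (⌊((lam : ℝ) - 1) / 2⌋ : ℝ) = t := by
    have h : ⌊((lam : ℝ) - 1) / 2⌋ = (t : ℤ) := by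
      have := Nat.floor_div_eq_div (K := ℝ) (lam - 1) 2
      rw [← ht, Nat.cast_sub hlam] at this
      push_cast at this
      rw [← this, Int.natCast_floor_eq_floor]
      have : (1 : ℝ) ≤ lam := by exact_mod_cast hlam
      linarith
    rw [h]
    simp
  rw [hfloor]
  obtain ⟨M, hM⟩ := Filter.eventually_atTop.1 (eventually_mul_sub_logb_le t)
  refine Set.infinite_of_not_bddAbove ?_
  rintro ⟨B, hB⟩
  set m := max (max M B) 1 with hm
  obtain ⟨hle, hle', hlog⟩ := hM m (by omega)
  set s := 2 ^ m - 1 - m * t with hs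
  have hmem : 2 ^ m ∈ codeLengthSet (2 ^ s) lam := by
    refine codeLengthSet_anti (lam' := 2 * t + 2) (by omega)
      (mem_codeLengthSet_two_pow (by omega) ?_)
    rw [← pow_mul, ← pow_succ', ← pow_add]
    exact (congrArg (2 ^ ·) (by omega : s + (m * t + 1) = 2 ^ m)).le
  have hcap := cap_le_of_mem_codeLengthSet hmem
  have hlt : B < 2 ^ s := (by omega : B ≤ s).trans_lt Nat.lt_two_pow_self
  refine hlt.not_ge (hB ?_)
  have hs2 : ((2 ^ m : ℕ) : ℝ) = s + 1 + m * t := by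
    exact_mod_cast (by omega : 2 ^ m = s + 1 + m * t)
  have hcap' : (cap (2 ^ s) lam : ℝ) ≤ ((2 ^ s : ℕ) : ℝ) * ((2 ^ m : ℕ) : ℝ) := by
    exact_mod_cast hcap
  refine hcap'.trans (mul_le_mul_of_nonneg_left ?_ (Nat.cast_nonneg _))
  have hls : Real.logb 2 ((2 ^ s : ℕ) : ℝ) = s := by
    rw [Nat.cast_pow, Nat.cast_ofNat, Real.logb_pow, Real.logb_self_eq_one one_lt_two, mul_one]
  rw [hls, hs2]
  linarith

theorem theorem1p2 :
    (∀ n lam : ℕ, 1 ≤ n → 1 ≤ lam → cap n lam ≤ n * minCodeLength n lam) ∧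
    (∀ n : ℕ, 2 ≤ n →
      (cap n 2 : ℝ) ≤ (n : ℝ) * ((⌈Real.logb 2 (n : ℝ)⌉ : ℝ) + 1) ∧
      (n : ℝ) * ((⌈Real.logb 2 (n : ℝ)⌉ : ℝ) + 1) < (n : ℝ) * (Real.logb 2 (n : ℝ) + 2)) ∧
    (∀ n lam : ℕ, 1 ≤ n → 2 ≤ lam → (lam : ℝ) ≤ (1 / 2 : ℝ) * Real.logb 2 (n : ℝ) →
      (cap n lam : ℝ) ≤ (n : ℝ) * (Real.logb 2 (n : ℝ) +
        ((lam : ℝ) - 1) * (Real.logb 2 (Real.logb 2 (n : ℝ) / ((lam : ℝ) - 1)) + 4))) ∧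
    (∀ c : ℝ, 0 < c → c < 1 / 2 → ∀ n lam : ℕ, 1 ≤ n → 1 ≤ lam →
      c * (Real.logb 2 (n : ℝ) / (1 - binaryEntropy c)) ≤ (lam : ℝ) →
      (cap n lam : ℝ) ≤ (lam : ℝ) / c * (n : ℝ)) ∧
    (∀ lam : ℕ, 1 ≤ lam →
      {n : ℕ | (cap n lam : ℝ) ≤ (n : ℝ) * (Real.logb 2 (n : ℝ) +
        (⌊((lam : ℝ) - 1) / 2⌋ : ℝ) * Real.logb 2 (Real.logb 2 (n : ℝ)) + 2)}.Infinite) := by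
  refine ⟨fun n lam _ _ =>
      cap_le_of_mem_codeLengthSet (Nat.sInf_mem (codeLengthSet_nonempty n lam)),
    fun n hn => ⟨cap_two_le hn, ?_⟩, fun n lam hn hlam h => cap_le_of_le_half_logb hn hlam h,
    fun c hc0 hc n lam hn hlam h => cap_le_of_binaryEntropy hc0 hc hn hlam h,
    fun lam hlam => infinite_setOf_cap_le hlam⟩
  have hn0 : (0 : ℝ) < n := by positivity
  have := Int.ceil_lt_add_one (Real.logb 2 (n : ℝ))
  exact mul_lt_mul_of_pos_left (by linarith) hn0
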